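/- Theorem 3.1. Let $n\ge 1$. Let $V_n$ be the set of words $\sigma=\sigma_1\cdots\sigma_{2n-1}$ of nonzero integers such that the multiset of absolute values $|\sigma_1|,\dots,|\sigma_{2n-1}|$ is $\{1^2,2^2,\dots,(n-1)^2,n\}$ (each of $1,\dots,n-1$ occurs twice and $n$ occurs once) and the letter of absolute value $n$ is negative; the other letters may have either sign. For such $\sigma$ let $$\mathrm{des}_B(\sigma)=\#\{\,i : 1\le i\le 2n-2,\ \sigma_i>\sigma_{i+1}\,\}+\begin{cases}1&\text{if }\sigma_{2n-1}>0,\\0&\text{otherwise.}\end{cases}$$ Let $s=(s_1,s_2,\dots)=(1,4,3,8,5,12,\dots)$, that is, $s_{2i}=4i$ and $s_{2i-1}=2i-1$ for $i\ge1$. Let $I_{2n-1}$ be the set of integer sequences $e=(e_1,\dots,e_{2n-1})$ with $0\le e_i<s_i$ for all $i$, and let $\mathrm{asc}(e)$ be the number of $i\in\{0,1,\dots,2n-2\}$ with $e_i/s_i<e_{i+1}/s_{i+1}$, where $e_0=0$ and $s_0=1$. Then $$\sum_{\sigma\in V_n}x^{\mathrm{des}_B(\sigma)}=\sum_{e\in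 I_{2n-1}}x^{\mathrm{asc}(e)}.$$ Moreover, writing $V_n(x)$ for the sum on the left, as formal power series in $x$, $$\frac{V_n(x)}{(1-x)^{2n}}=\sum_{t\ge0}(t+1)^n(2t+1)^{n-1}x^t.$$ -/

import Mathlib

namespace SignedInv

/-- The signed letters coming from a multiset `M` of positive integers:
each element of `M`, with or without a minus sign. -/
def signedLetters (M : Multiset ℕ) : Finset ℤ :=
  M.toFinset.image (fun k : ℕ => (k : ℤ)) ∪ M.toFinset.image (fun k : ℕ => -(k : ℤ))

/-- The signed permutations on a multiset `M` of `m` positive integers, as words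
`σ = (σ 0, …, σ (m - 1))` of integers: the absolute values of the letters, with multiplicity,
form `M`, and each letter carries an arbitrary sign. -/
def signedPerms (m : ℕ) (M : Multiset ℕ) : Finset (Fin m → ℤ) :=
  (Fintype.piFinset fun _ : Fin m => signedLetters M).filter fun σ =>
    (Finset.univ : Finset (Fin m)).val.map (fun i => (σ i).natAbs) = M

/-- The ambient finite set in the definition of `signedPerms` imposes no condition. -/
theorem mem_signedPerms {m : ℕ} {M : Multiset ℕ} {σ : Fin m → ℤ} :
    σ ∈ signedPerms m M ↔
      (Finset.univ : Finset (Fin m)).val.map (fun i => (σ i).natAbs) = M := by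
  refine ⟨fun h => (Finset.mem_filter.1 h).2, fun h => Finset.mem_filter.2 ⟨?_, h⟩⟩
  refine Fintype.mem_piFinset.2 fun i => ?_
  have hi : (σ i).natAbs ∈ M := by
    rw [← h]
    exact Multiset.mem_map.2 ⟨i, Finset.mem_univ i, rfl⟩
  rcases Int.natAbs_eq (σ i) with h' | h'
  · exact Finset.mem_union_left _
      (Finset.mem_image.2 ⟨_, Multiset.mem_toFinset.2 hi, h'.symm⟩)
  · exact Finset.mem_union_right _
      (Finset.mem_image.2 ⟨_, Multiset.mem_toFinset.2 hi, h'.symm⟩)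

/-- The multiset `{1², 2², …, (n-1)², n}` (for `n ≥ 1`). -/
def baseMultiset (n : ℕ) : Multiset ℕ :=
  2 • (Finset.Icc 1 (n - 1)).val + {n}

/-- `U n`: the signed permutations on `{1², 2², …, (n-1)², n}`. -/
def U (n : ℕ) : Finset (Fin (2 * n - 1) → ℤ) :=
  signedPerms (2 * n - 1) (baseMultiset n)

/-- `V n`: the elements of `U n` in which the element `n` carries a minus sign. -/
def V (n : ℕ) : Finset (Fin (2 * n - 1) → ℤ) :=
  (U n).filter fun σ => ∃ i, σ i = -(n : ℤ)

/-- The type `B` descent set of a word `σ₁ ⋯ σₘ`: the positions `i < m` with `σᵢ > σᵢ₊₁`,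
together with the last position `m` if `σₘ > 0`.
The position `i + 1` of the usual numbering is `i : Fin m`. -/
def DesB {m : ℕ} (σ : Fin m → ℤ) : Finset (Fin m) :=
  Finset.univ.filter fun i : Fin m =>
    if h : i.val + 1 < m then σ i > σ ⟨i.val + 1, h⟩ else σ i > 0

/-- The descent number. -/
def desB {m : ℕ} (σ : Fin m → ℤ) : ℕ := (DesB σ).card

/-- The `s`-inversion sequences `(e₁, …, eₘ)`, `0 ≤ eᵢ < sᵢ`; the entry `eᵢ₊₁` is `e i`
for `i : Fin m`. -/
def inversionSeqs (s : ℕ → ℕ) (m : ℕ) : Finset (Fin m → ℕ) :=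
  Fintype.piFinset fun i : Fin m => Finset.range (s (i.val + 1))

/-- The ascents of an inversion sequence: the `i ∈ {0, …, m - 1}` with
`eᵢ / sᵢ < eᵢ₊₁ / sᵢ₊₁`, where `e₀ = 0` (prepended by `Fin.cons`) and `s 0` is to be `1`. -/
def Asc (s : ℕ → ℕ) {m : ℕ} (e : Fin m → ℕ) : Finset (Fin m) :=
  let e' : Fin (m + 1) → ℕ := Fin.cons 0 e
  Finset.univ.filter fun i : Fin m =>
    (e' i.castSucc : ℚ) / (s i.val : ℚ) < (e' i.succ : ℚ) / (s (i.val + 1) : ℚ)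

/-- The ascent number. -/
def asc (s : ℕ → ℕ) {m : ℕ} (e : Fin m → ℕ) : ℕ := (Asc s e).card

/-- The sequence `(s₁, s₂, …) = (1, 4, 3, 8, 5, 12, …)`, that is `s₂ᵢ = 4i` and
`s₂ᵢ₋₁ = 2i - 1` for `i ≥ 1`, with the convention `s₀ = 1`. -/
def sSeq (k : ℕ) : ℕ :=
  if k = 0 then 1 else if Even k then 2 * k else k

/-- `I m`: the inversion sequences of length `m` for `s = (1, 4, 3, 8, 5, 12, …)`. -/
def I (m : ℕ) : Finset (Fin m → ℕ) := inversionSeqs sSeq m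

end SignedInv

/-! Both sums equal `(1 - X) ^ (2n)` times the series with coefficients `(t+1)^n (2t+1)^(n-1)`. Each
is found by removing the last letter or entry, after refining the statistic by what comes next: a
bound `r` for words, a ratio `y` for inversion sequences. The coefficients are then values of a
counting function whose increment is the same count one size smaller, and `sum_level_series` turns
this recursion into one extra factor `1 - X`. For words the count is of multisets drawn from a
periodic alphabet, and Pascal's rule gives the recursion (`contentCount_succ_sub`). For inversion
sequences it is the lecture hall count, whose product form for this `s` satisfies the recursion
(`lectureHallCount_sub`). The two counts are evaluated in `contentCount_baseMultiset` and
`lectureHallCount_mul`. -/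

open PowerSeries in
/-- Splitting a telescoping sum into residue classes modulo `q`. -/
theorem sum_level_series (H : ℕ → ℚ) (hH : H 0 = 0) {q r : ℕ} (hr : r ≤ q) :
    ∑ j ∈ Finset.range q, (X : PowerSeries ℚ) ^ (if r ≤ j then 1 else 0) *
        PowerSeries.mk (fun v => H (v * q + j + 1) - H (v * q + j))
      = (1 - X) * PowerSeries.mk (fun t => H (t * q + r)) := by
  have hlow : ∀ v, ∑ j ∈ Finset.range r, (H (v * q + j + 1) - H (v * q + j))
      = H (v * q + r) - H (v * q) := fun v => by
    simpa [add_assoc] using Finset.sum_range_sub (fun j => H (v * q + j)) r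
  have hall : ∀ v, ∑ j ∈ Finset.range q, (H (v * q + j + 1) - H (v * q + j))
      = H (v * q + q) - H (v * q) := fun v => by
    simpa [add_assoc] using Finset.sum_range_sub (fun j => H (v * q + j)) q
  rw [← Finset.sum_range_add_sum_Ico _ hr]
  have h1 : ∑ j ∈ Finset.range r, (X : PowerSeries ℚ) ^ (if r ≤ j then 1 else 0) *
        PowerSeries.mk (fun v => H (v * q + j + 1) - H (v * q + j))
      = PowerSeries.mk (fun v => H (v * q + r) - H (v * q)) := by
    ext v
    rw [map_sum, coeff_mk, ← hlow]
    refine Finset.sum_congr rfl fun j hj => ?_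
    simp [(Finset.mem_range.1 hj).not_ge]
  have h2 : ∑ j ∈ Finset.Ico r q, (X : PowerSeries ℚ) ^ (if r ≤ j then 1 else 0) *
        PowerSeries.mk (fun v => H (v * q + j + 1) - H (v * q + j))
      = X * PowerSeries.mk (fun v => H (v * q + q) - H (v * q + r)) := by
    have : ∀ j ∈ Finset.Ico r q, (X : PowerSeries ℚ) ^ (if r ≤ j then 1 else 0) *
        PowerSeries.mk (fun v => H (v * q + j + 1) - H (v * q + j)) =
        X * PowerSeries.mk (fun v => H (v * q + j + 1) - H (v * q + j)) := fun j hj => by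
      simp [(Finset.mem_Ico.1 hj).1]
    rw [Finset.sum_congr rfl this, ← Finset.mul_sum]
    congr 1
    ext v
    rw [map_sum, coeff_mk]
    simp only [coeff_mk]
    have := hall v
    rw [← Finset.sum_range_add_sum_Ico _ hr, hlow v] at this
    linarith
  rw [h1, h2]
  ext t
  cases t with
  | zero => simp [sub_mul, hH]
  | succ t =>
    simp only [sub_mul, one_mul, map_add, map_sub, coeff_mk, coeff_succ_X_mul]
    rw [show (t + 1) * q = t * q + q by ring]
    ring

/-! ### Lecture hall counts: product form and difference relation. -/

namespace SignedInv

/-- The factor multiplying the floor in the recursion for lecture hall counts. -/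
def floorWeight (m : ℕ) : ℚ := if m = 0 then 0 else if Even m then 1 / 2 else 2

/-- `lectureHallCount m z` is the number of integer sequences with
`0 ≤ λ₁ / s₁ ≤ ⋯ ≤ λₘ / sₘ` and `λₘ ≤ z`, for `s = sSeq`, in product form. -/
def lectureHallCount : ℕ → ℤ → ℚ
  | 0, z => if z < 0 then 0 else 1
  | m + 1, z => lectureHallCount m (sSeq m * z / sSeq (m + 1)) *
      (z + 1 - floorWeight m * ((sSeq m * z / sSeq (m + 1) : ℤ) : ℚ))

theorem sSeq_pos (m : ℕ) : 0 < sSeq m := by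
  unfold sSeq; split_ifs <;> omega

theorem lectureHallCount_neg (m : ℕ) {z : ℤ} (hz : z < 0) : lectureHallCount m z = 0 := by
  induction m generalizing z with
  | zero => simp [lectureHallCount, hz]
  | succ m ih =>
    have h1 : (0 : ℤ) < sSeq m := by exact_mod_cast sSeq_pos m
    have h2 : (0 : ℤ) < sSeq (m + 1) := by exact_mod_cast sSeq_pos (m + 1)
    rw [lectureHallCount, ih, zero_mul]
    exact Int.ediv_neg_of_neg_of_pos (by nlinarith) h2

theorem sSeq_even (i : ℕ) : sSeq (2 * i + 2) = 4 * (i + 1) := by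
  simp [sSeq, show Even (2 * i + 2) from ⟨i + 1, by ring⟩]; ring

theorem sSeq_odd (i : ℕ) : sSeq (2 * i + 1) = 2 * i + 1 := by
  simp [sSeq]

theorem lectureHallCount_one (z : ℤ) :
    lectureHallCount 1 z = if z < 0 then 0 else (z : ℚ) + 1 := by
  simp [lectureHallCount, floorWeight, sSeq]

theorem lectureHallCount_odd (i : ℕ) (z : ℤ) :
    lectureHallCount (2 * i + 3) z =
      lectureHallCount (2 * i + 2) (4 * (i + 1) * z / (2 * i + 3)) *
        (z + 1 - 1 / 2 * ((4 * (i + 1) * z / (2 * i + 3) : ℤ) : ℚ)) := by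
  rw [lectureHallCount, floorWeight, sSeq_even, show 2 * i + 2 + 1 = 2 * (i + 1) + 1 by ring,
    sSeq_odd, if_neg (by omega), if_pos ⟨i + 1, by ring⟩]
  push_cast
  ring_nf

theorem lectureHallCount_even (i : ℕ) (z : ℤ) :
    lectureHallCount (2 * i + 2) z =
      lectureHallCount (2 * i + 1) ((2 * i + 1) * z / (4 * (i + 1))) *
        (z + 1 - 2 * (((2 * i + 1) * z / (4 * (i + 1)) : ℤ) : ℚ)) := by
  rw [lectureHallCount, floorWeight, sSeq_even, sSeq_odd, if_neg (by omega),
    if_neg (by simp)]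
  push_cast
  ring_nf

theorem lectureHallCount_one_sub (z : ℤ) :
    lectureHallCount 1 z - lectureHallCount 1 (z - 1) = lectureHallCount 0 z := by
  rw [lectureHallCount_one, lectureHallCount_one, lectureHallCount]
  rcases lt_trichotomy z 0 with h | rfl | h
  · rw [if_pos h, if_pos (by omega), if_pos h]; simp
  · simp
  · rw [if_neg (by omega), if_neg (by omega), if_neg (by omega)]; push_cast; ring

/-- From `z - 1` to `z` the floor `M` rises by 0 or 1. If it stays, only the linear factor grows, by
1; if it rises, the claim is exactly `h` with `q = z - 2M`. -/
theorem lectureHallCount_even_sub_of_odd_mul (i : ℕ)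
    (h : ∀ M q : ℤ, (2 * i + 1) * (q - 1) < 2 * M → 2 * M ≤ (2 * i + 1) * q →
      lectureHallCount (2 * i + 1) M * q = lectureHallCount (2 * i + 1) (M - 1) * (q + 2))
    (z : ℤ) :
    lectureHallCount (2 * i + 2) z - lectureHallCount (2 * i + 2) (z - 1) =
      lectureHallCount (2 * i + 1) ((2 * i + 1) * z / (4 * (i + 1))) := by
  have hi : (0 : ℤ) ≤ i := by positivity
  have hd : (0 : ℤ) < 4 * (i + 1) := by positivity
  rw [lectureHallCount_even, lectureHallCount_even]
  have hM1 := Int.mul_ediv_self_le (x := (2 * i + 1) * z) (k := 4 * ((i : ℤ) + 1)) hd.ne'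
  have hM2 := Int.lt_mul_ediv_self_add (x := (2 * i + 1) * z) hd
  have hN1 := Int.mul_ediv_self_le (x := (2 * i + 1) * (z - 1)) (k := 4 * ((i : ℤ) + 1)) hd.ne'
  have hN2 := Int.lt_mul_ediv_self_add (x := (2 * i + 1) * (z - 1)) hd
  set M := (2 * (i : ℤ) + 1) * z / (4 * (i + 1))
  set M' := (2 * (i : ℤ) + 1) * (z - 1) / (4 * (i + 1))
  have h1 : M' ≤ M := by
    by_contra hc
    nlinarith [show M + 1 ≤ M' by omega]
  have h2 : M ≤ M' + 1 := by
    by_contra hc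
    nlinarith [show M' + 2 ≤ M by omega]
  rcases eq_or_lt_of_le h1 with h3 | h3
  · rw [h3]; push_cast; ring
  · have h4 : M' = M - 1 := by omega
    rw [h4] at hN1 hN2 ⊢
    have := h M (z - 2 * M) (by nlinarith) (by nlinarith)
    push_cast at this ⊢
    linear_combination this

/-- The general difference relation in odd index, in cross-multiplied form. -/
theorem lectureHallCount_odd_mul (i : ℕ)
    (h : ∀ z : ℤ, lectureHallCount (2 * i + 3) z - lectureHallCount (2 * i + 3) (z - 1) =
      lectureHallCount (2 * i + 2) (4 * (i + 1) * z / (2 * i + 3))) (M q : ℤ)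
    (h1 : (2 * i + 3) * (q - 1) < 2 * M) (h2 : 2 * M ≤ (2 * i + 3) * q) :
    lectureHallCount (2 * i + 3) M * q = lectureHallCount (2 * i + 3) (M - 1) * (q + 2) := by
  -- The bounds say `q = ⌈2M / (2i+3)⌉`, and `4(i+1) = 2(2i+3) - 2`. The linear factor thus becomes
  -- `(q+2)/2`.
  have hL : 4 * ((i : ℤ) + 1) * M / (2 * i + 3) = 2 * M - q := by
    rw [Int.ediv_eq_iff_of_pos (by positivity)]
    constructor <;> nlinarith
  have h3 := h M
  have h4 := lectureHallCount_odd i M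
  rw [hL] at h3 h4
  have h5 : lectureHallCount (2 * i + 3) (M - 1) =
    lectureHallCount (2 * i + 3) M - lectureHallCount (2 * i + 2) (2 * M - q) := by linarith
  rw [h5, h4]
  push_cast
  ring

/-- The floor drops by 1 or 2 from `z` to `z - 1`. By `key`, neighbouring even-index values share an
odd-index factor; a drop of 2 uses `key` twice, linked by the common value at `2z - q - 1`. -/
theorem lectureHallCount_odd_sub (i : ℕ)
    (h : ∀ z : ℤ, lectureHallCount (2 * i + 2) z - lectureHallCount (2 * i + 2) (z - 1) =
      lectureHallCount (2 * i + 1) ((2 * i + 1) * z / (4 * (i + 1)))) (z : ℤ) :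
    lectureHallCount (2 * i + 3) z - lectureHallCount (2 * i + 3) (z - 1) =
      lectureHallCount (2 * i + 2) (4 * (i + 1) * z / (2 * i + 3)) := by
  have hi : (0 : ℤ) ≤ i := by positivity
  have hd : (0 : ℤ) < 2 * i + 3 := by positivity
  have key : ∀ M L : ℤ, 4 * (i + 1) * L ≤ (2 * i + 1) * M →
      (2 * i + 1) * M < 4 * (i + 1) * (L + 1) →
      lectureHallCount (2 * i + 2) M = lectureHallCount (2 * i + 1) L * (M + 1 - 2 * L) ∧
      lectureHallCount (2 * i + 2) (M - 1) = lectureHallCount (2 * i + 1) L * (M - 2 * L) := by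
    intro M L hl hu
    have hL : (2 * (i : ℤ) + 1) * M / (4 * (i + 1)) = L := by
      rw [Int.ediv_eq_iff_of_pos (by positivity)]
      constructor <;> nlinarith
    have e1 := lectureHallCount_even i M
    have e2 := h M
    rw [hL] at e1 e2
    exact ⟨e1, by linear_combination e1 - e2⟩
  rw [lectureHallCount_odd, lectureHallCount_odd]
  have hM1 := Int.mul_ediv_self_le (x := 4 * ((i : ℤ) + 1) * z) hd.ne'
  have hM2 := Int.lt_mul_ediv_self_add (x := 4 * ((i : ℤ) + 1) * z) hd
  have hN1 := Int.mul_ediv_self_le (x := 4 * ((i : ℤ) + 1) * (z - 1)) hd.ne'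
  have hN2 := Int.lt_mul_ediv_self_add (x := 4 * ((i : ℤ) + 1) * (z - 1)) hd
  generalize 4 * ((i : ℤ) + 1) * z / (2 * i + 3) = M at *
  generalize 4 * ((i : ℤ) + 1) * (z - 1) / (2 * i + 3) = M' at *
  obtain ⟨q, rfl⟩ : ∃ q, M = 2 * z - q := ⟨2 * z - M, by ring⟩
  have h1 : M' ≤ 2 * z - q - 1 := by
    by_contra hc
    nlinarith [show 2 * z - q ≤ M' by omega]
  have h2 : 2 * z - q - 2 ≤ M' := by
    by_contra hc
    nlinarith [show M' + 1 ≤ 2 * z - q - 2 by omega]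
  obtain ⟨e1, e2⟩ := key (2 * z - q) (z - q) (by nlinarith) (by nlinarith)
  rcases eq_or_lt_of_le h1 with rfl | h3
  · rw [e1, e2]
    push_cast
    ring
  · obtain rfl : M' = 2 * z - q - 1 - 1 := by omega
    obtain ⟨e3, e4⟩ := key (2 * z - q - 1) (z - q - 1) (by nlinarith) (by nlinarith)
    have e5 := e2.symm.trans e3
    rw [e1, e4]
    push_cast at e5 ⊢
    linear_combination (q + 1 : ℚ) / 2 * e5

theorem lectureHallCount_two_sub (z : ℤ) :
    lectureHallCount 2 z - lectureHallCount 2 (z - 1) =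
      lectureHallCount 1 ((2 * (0 : ℕ) + 1) * z / (4 * ((0 : ℕ) + 1))) := by
  refine lectureHallCount_even_sub_of_odd_mul 0 (fun M q h1 h2 => ?_) z
  obtain rfl : q = 2 * M := by push_cast at h1 h2; omega
  simp only [mul_zero, zero_add, lectureHallCount_one]
  rcases lt_trichotomy M 0 with h | rfl | h
  · rw [if_pos h, if_pos (by omega)]; simp
  · simp
  · rw [if_neg (by omega), if_neg (by omega)]; push_cast; ring

/-- The induction alternates parity: the even relation gives the odd one, whose cross-multiplied
form gives the next even one. -/
theorem lectureHallCount_sub_aux (i : ℕ) :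
    (∀ z : ℤ, lectureHallCount (2 * i + 2) z - lectureHallCount (2 * i + 2) (z - 1) =
      lectureHallCount (2 * i + 1) ((2 * i + 1) * z / (4 * (i + 1)))) ∧
    ∀ z : ℤ, lectureHallCount (2 * i + 3) z - lectureHallCount (2 * i + 3) (z - 1) =
      lectureHallCount (2 * i + 2) (4 * (i + 1) * z / (2 * i + 3)) := by
  induction i with
  | zero => exact ⟨lectureHallCount_two_sub, lectureHallCount_odd_sub 0 lectureHallCount_two_sub⟩
  | succ i ih =>
    have h : ∀ z : ℤ,
        lectureHallCount (2 * (i + 1) + 2) z - lectureHallCount (2 * (i + 1) + 2) (z - 1) =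
          lectureHallCount (2 * (i + 1) + 1)
            ((2 * (i + 1 : ℕ) + 1) * z / (4 * ((i + 1 : ℕ) + 1))) :=
      lectureHallCount_even_sub_of_odd_mul (i + 1) fun M q h1 h2 =>
        lectureHallCount_odd_mul i ih.2 M q (by push_cast at h1; linarith)
          (by push_cast at h2; linarith)
    exact ⟨h, lectureHallCount_odd_sub (i + 1) h⟩

/-- The difference relation characterising the lecture hall counts. -/
theorem lectureHallCount_sub (m : ℕ) (z : ℤ) :
    lectureHallCount (m + 1) z - lectureHallCount (m + 1) (z - 1) =
      lectureHallCount m (sSeq m * z / sSeq (m + 1)) := by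
  rcases m with _ | m
  · rw [lectureHallCount_one_sub]; simp [sSeq]
  rcases Nat.even_or_odd' m with ⟨i, rfl | rfl⟩
  · rw [(lectureHallCount_sub_aux i).1, sSeq_even, sSeq_odd]; push_cast; rfl
  · rw [(lectureHallCount_sub_aux i).2, show 2 * i + 1 + 1 + 1 = 2 * (i + 1) + 1 by ring,
      sSeq_even, sSeq_odd]
    push_cast
    ring_nf

/-- At multiples of `sSeq m` every floor is exact, so an odd step contributes `t + 1` and an even
step `2t + 1`. -/
theorem lectureHallCount_mul (i t : ℕ) :
    lectureHallCount (2 * i + 1) ((sSeq (2 * i + 1) : ℤ) * t) =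
      ((t : ℚ) + 1) ^ (i + 1) * (2 * t + 1) ^ i := by
  induction i with
  | zero =>
    have : ¬ (t : ℤ) < 0 := by omega
    simp [lectureHallCount_one, sSeq]
  | succ i ih =>
    rw [sSeq_odd] at ih ⊢
    have h1 : (4 * ((i : ℤ) + 1) * (((2 * (i + 1) + 1 : ℕ) : ℤ) * t) / (2 * i + 3)) =
        4 * (i + 1) * t := by
      rw [Int.ediv_eq_iff_of_pos (by positivity)]
      push_cast
      constructor <;> nlinarith
    have h2 : (2 * (i : ℤ) + 1) * (4 * (i + 1) * t) / (4 * (i + 1)) =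
        ((2 * i + 1 : ℕ) : ℤ) * t := by
      rw [Int.ediv_eq_iff_of_pos (by positivity)]
      push_cast
      constructor <;> nlinarith
    rw [show 2 * (i + 1) + 1 = 2 * i + 3 by ring] at h1 ⊢
    rw [lectureHallCount_odd, h1, lectureHallCount_even, h2, ih]
    push_cast
    ring

end SignedInv

/-! ### Inversion sequences by ascents. -/

namespace SignedInv

open PowerSeries Finset

theorem asc_eq_sum (s : ℕ → ℕ) {m : ℕ} (e : Fin m → ℕ) :
    asc s e = ∑ i : Fin m, if ((Fin.cons 0 e : Fin (m + 1) → ℕ) i.castSucc : ℚ) / (s i.val : ℚ)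
        < ((Fin.cons 0 e : Fin (m + 1) → ℕ) i.succ : ℚ) / (s (i.val + 1) : ℚ) then 1 else 0 := by
  rw [asc, Asc, Finset.card_filter]

/-- The last entry of `(0, e₁, …, eₘ)` divided by `sₘ`. -/
def lastRatio (s : ℕ → ℕ) {m : ℕ} (e : Fin m → ℕ) : ℚ :=
  ((Fin.cons 0 e : Fin (m + 1) → ℕ) (Fin.last m) : ℚ) / s m

theorem lastRatio_snoc (s : ℕ → ℕ) {m : ℕ} (e : Fin m → ℕ) (b : ℕ) :
    lastRatio s (Fin.snoc e b : Fin (m + 1) → ℕ) = b / s (m + 1) := by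
  rw [lastRatio, Fin.cons_snoc_eq_snoc_cons, Fin.snoc_last]

theorem asc_snoc (s : ℕ → ℕ) {m : ℕ} (e : Fin m → ℕ) (b : ℕ) :
    asc s (Fin.snoc e b : Fin (m + 1) → ℕ) =
      asc s e + if lastRatio s e < b / s (m + 1) then 1 else 0 := by
  rw [asc_eq_sum, Fin.sum_univ_castSucc, asc_eq_sum, Fin.cons_snoc_eq_snoc_cons]
  congr 1
  · refine Finset.sum_congr rfl fun i _ => ?_
    rw [Fin.snoc_castSucc, ← Fin.castSucc_succ, Fin.snoc_castSucc]
    rfl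
  · rw [Fin.snoc_castSucc, Fin.succ_last, Fin.snoc_last]
    rfl

theorem sum_inversionSeqs_succ {β : Type*} [AddCommMonoid β] (s : ℕ → ℕ) (m : ℕ)
    (f : (Fin (m + 1) → ℕ) → β) :
    ∑ e ∈ inversionSeqs s (m + 1), f e =
      ∑ b ∈ range (s (m + 1)), ∑ e ∈ inversionSeqs s m, f (Fin.snoc e b) := by
  rw [← Finset.sum_product']
  refine (Finset.sum_bij' (fun p _ => (Fin.snoc p.2 p.1 : Fin (m + 1) → ℕ))
    (fun e _ => (e (Fin.last m), fun i => e i.castSucc)) ?_ ?_ ?_ ?_ ?_).symm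
  · rintro ⟨b, e⟩ h
    simp only [mem_product, mem_range, inversionSeqs, Fintype.mem_piFinset] at h ⊢
    intro i
    refine Fin.lastCases ?_ (fun i => ?_) i
    · simpa using h.1
    · simpa using h.2 i
  · intro e h
    simp only [mem_product, mem_range, inversionSeqs, Fintype.mem_piFinset] at h ⊢
    exact ⟨h (Fin.last m), fun i => h i.castSucc⟩
  · rintro ⟨b, e⟩ _
    simp
  · intro e _
    exact Fin.snoc_init_self e
  · intros; rfl

/-- The generating function of inversion sequences by ascents, followed by a ratio `y`. -/
theorem sum_inversionSeqs_sSeq (m : ℕ) (y : ℚ) (hy0 : 0 ≤ y) (hy1 : y < 1) :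
    ∑ e ∈ inversionSeqs sSeq m, (X : PowerSeries ℚ) ^
        (asc sSeq e + if lastRatio sSeq e < y then 1 else 0) =
      (1 - X) ^ (m + 1) *
        PowerSeries.mk fun t => lectureHallCount m ⌊(sSeq m : ℚ) * (t - y)⌋ := by
  induction m generalizing y with
  | zero =>
    -- Only the coefficient at `t = 0` sees whether `y > 0`, since `⌊-y⌋ < 0` exactly then.
    have h0 : ∀ t : ℕ, lectureHallCount 0 ⌊((sSeq 0 : ℕ) : ℚ) * (t - y)⌋ =
        if t = 0 ∧ 0 < y then 0 else 1 := by
      intro t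
      rw [lectureHallCount, sSeq]
      simp only [if_true, Nat.cast_one, one_mul]
      congr 1
      rw [Int.floor_lt, eq_iff_iff]
      rcases t with _ | t
      · simp
      · push_cast
        simp only [false_and, iff_false, not_lt]
        have : (0 : ℚ) ≤ t := by positivity
        linarith
    simp only [h0]
    have hs : inversionSeqs sSeq 0 = {Fin.elim0} := by
      ext e
      obtain rfl := Subsingleton.elim e Fin.elim0
      exact iff_of_true (Fintype.mem_piFinset.2 fun i => i.elim0) (mem_singleton_self _)
    rw [hs, Finset.sum_singleton]
    have ha : asc sSeq (Fin.elim0 : Fin 0 → ℕ) = 0 := by simp [asc_eq_sum]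
    have hl : lastRatio sSeq (Fin.elim0 : Fin 0 → ℕ) = 0 := by simp [lastRatio]
    rw [ha, hl]
    ext t
    rcases hy0.eq_or_lt with rfl | hy
    · rcases t with _ | t <;> simp [sub_mul, coeff_succ_X_mul]
    · rcases t with _ | _ | t <;> simp [sub_mul, coeff_succ_X_mul, hy, coeff_X]
  | succ m ih =>
    set s := sSeq (m + 1) with hs
    have hspos : 0 < s := sSeq_pos _
    have hsq : (0 : ℚ) < s := by exact_mod_cast hspos
    have hc0 : 0 ≤ ⌈(s : ℚ) * y⌉ := Int.ceil_nonneg (by positivity)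
    have hcs : ⌈(s : ℚ) * y⌉ ≤ s := Int.ceil_le.2 (by push_cast; nlinarith)
    -- The threshold `c = ⌈s y⌉` turns `b / s < y` into `b < c`.
    obtain ⟨c, hc⟩ := Int.eq_ofNat_of_zero_le hc0
    have hcle : c ≤ s := by rw [hc] at hcs; exact_mod_cast hcs
    have hsc : ∀ b : ℕ, (b : ℚ) / s < y ↔ b < c := by
      intro b
      rw [div_lt_iff₀ hsq, mul_comm y, ← not_le, ← Int.cast_natCast b, ← Int.ceil_le, hc]
      omega
    rw [sum_inversionSeqs_succ]
    simp only [lastRatio_snoc, asc_snoc, ← hs]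
    have hstep : ∀ b ∈ range s,
        ∑ e ∈ inversionSeqs sSeq m, (X : PowerSeries ℚ) ^
          ((asc sSeq e + if lastRatio sSeq e < b / s then 1 else 0) +
            if (b : ℚ) / s < y then 1 else 0) =
        (1 - X) ^ (m + 1) * (X ^ (if b < c then 1 else 0) *
          PowerSeries.mk fun t => lectureHallCount (m + 1) (t * s - b) -
            lectureHallCount (m + 1) (t * s - b - 1)) := by
      intro b hb
      simp only [hsc, pow_add _ _ (if b < c then 1 else 0)]
      rw [← Finset.sum_mul, ih (b / s) (by positivity)
        ((div_lt_one hsq).2 (by exact_mod_cast mem_range.1 hb))]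
      simp only [lectureHallCount_sub]
      have : ∀ t : ℕ, ⌊(sSeq m : ℚ) * (t - b / s)⌋ = sSeq m * ((t : ℤ) * s - b) / s := by
        intro t
        rw [← Rat.floor_intCast_div_natCast]
        congr 1
        push_cast
        field_simp
      simp only [this]
      ring
    rw [Finset.sum_congr rfl hstep, ← Finset.mul_sum, ← Finset.sum_range_reflect]
    -- Reflection `b = s - 1 - j` makes the arguments increase with `j`; the shift by `s` makes the
    -- function vanish at 0.
    have key := sum_level_series (fun p => lectureHallCount (m + 1) ((p : ℤ) - s))
      (lectureHallCount_neg _ (by push_cast; omega)) (q := s) (r := s - c) (by omega)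
    have hconv : ∀ j ∈ range s, (X : PowerSeries ℚ) ^ (if s - 1 - j < c then 1 else 0) *
          (PowerSeries.mk fun t => lectureHallCount (m + 1) (t * s - (s - 1 - j : ℕ)) -
            lectureHallCount (m + 1) (t * s - (s - 1 - j : ℕ) - 1)) =
        X ^ (if s - c ≤ j then 1 else 0) * PowerSeries.mk fun v =>
          lectureHallCount (m + 1) (((v * s + j + 1 : ℕ) : ℤ) - s) -
          lectureHallCount (m + 1) (((v * s + j : ℕ) : ℤ) - s) := by
      intro j hj
      have hj := mem_range.1 hj
      have h1 : s - 1 - j < c ↔ s - c ≤ j := by omega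
      simp only [h1]
      congr 2
      ext t
      have h2 : ((s - 1 - j : ℕ) : ℤ) = s - 1 - j := by omega
      rw [h2]
      push_cast
      congr 2 <;> ring
    rw [Finset.sum_congr rfl hconv, key, pow_succ _ (m + 1), mul_assoc]
    congr 3
    ext t
    congr 1
    have : ⌊(s : ℚ) * (t - y)⌋ = (s : ℤ) * t - c := by
      rw [mul_sub, ← hc, show (s : ℚ) * t = ((s * t : ℤ) : ℚ) by push_cast; rfl,
        sub_eq_add_neg, Int.floor_intCast_add, Int.floor_neg, sub_eq_add_neg]
    rw [this]
    have : ((s - c : ℕ) : ℤ) = s - c := by omega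
    push_cast [this]
    ring

/-- With `y = 0` the following ratio creates no ascent. -/
theorem sum_asc_I (i : ℕ) :
    ∑ e ∈ I (2 * i + 1), (X : PowerSeries ℚ) ^ asc sSeq e = (1 - X) ^ (2 * i + 2) *
      PowerSeries.mk fun t : ℕ => ((t : ℚ) + 1) ^ (i + 1) * (2 * t + 1) ^ i := by
  have h := sum_inversionSeqs_sSeq (2 * i + 1) 0 le_rfl one_pos
  have hl : ∀ e : Fin (2 * i + 1) → ℕ, ¬ lastRatio sSeq e < 0 := fun e =>
    not_lt.2 (div_nonneg (Nat.cast_nonneg _) (Nat.cast_nonneg _))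
  simp only [hl, if_false, add_zero, sub_zero] at h
  rw [I, h]
  congr 2
  ext t
  rw [← lectureHallCount_mul]
  congr 1
  exact_mod_cast Int.floor_intCast _

end SignedInv

/-! ### Words of given content by descents. -/

namespace SignedInv

open PowerSeries Finset

/-- Words of length `m` in the letters `0, …, q - 1` whose classes under `κ` form `M`. -/
def wordsOfContent (q : ℕ) (κ : ℕ → ℕ) (m : ℕ) (M : Multiset ℕ) : Finset (Fin m → ℕ) :=
  (Fintype.piFinset fun _ : Fin m => range q).filter fun w =>
    (Finset.univ : Finset (Fin m)).val.map (fun i => κ (w i)) = M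

/-- The descents of a word followed by a bound `r`; a last letter `≥ r` is a descent. -/
def desBounded {m : ℕ} (r : ℕ) (w : Fin m → ℕ) : ℕ :=
  ∑ i : Fin m, if (Fin.snoc (fun j => w j + 1) r : Fin (m + 1) → ℕ) i.succ ≤ w i then 1 else 0

/-- A following letter `b` acts as the bound `b + 1`, since `b < a` means `b + 1 ≤ a`. -/
theorem desBounded_snoc {m : ℕ} (r : ℕ) (w : Fin m → ℕ) (b : ℕ) :
    desBounded r (Fin.snoc w b : Fin (m + 1) → ℕ) =
      desBounded (b + 1) w + if r ≤ b then 1 else 0 := by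
  rw [desBounded, Fin.sum_univ_castSucc, desBounded]
  congr 1
  · refine Finset.sum_congr rfl fun i _ => ?_
    rw [← Fin.castSucc_succ, Fin.snoc_castSucc, Fin.snoc_castSucc]
    congr 2
    refine Fin.lastCases ?_ (fun j => ?_) i.succ <;> simp
  · simp

theorem map_univ_snoc {α β : Type*} {m : ℕ} (κ : α → β) (w : Fin m → α) (b : α) :
    (Finset.univ : Finset (Fin (m + 1))).val.map
        (fun i => κ ((Fin.snoc w b : Fin (m + 1) → α) i)) =
      κ b ::ₘ (Finset.univ : Finset (Fin m)).val.map (fun i => κ (w i)) := by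
  rw [Fin.univ_castSuccEmb, Finset.cons_val, Multiset.map_cons, Finset.map_val,
    Multiset.map_map]
  simp only [Function.comp_def, Fin.coe_castSuccEmb, Fin.snoc_castSucc, Fin.snoc_last]

theorem sum_wordsOfContent_succ {β : Type*} [AddCommMonoid β] (q : ℕ) (κ : ℕ → ℕ) (m : ℕ)
    (M : Multiset ℕ) (f : (Fin (m + 1) → ℕ) → β) :
    ∑ w ∈ wordsOfContent q κ (m + 1) M, f w = ∑ b ∈ range q,
      if κ b ∈ M then ∑ w ∈ wordsOfContent q κ m (M.erase (κ b)), f (Fin.snoc w b) else 0 := by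
  rw [← Finset.sum_filter, Finset.sum_sigma']
  refine (Finset.sum_bij' (fun p _ => (Fin.snoc p.2 p.1 : Fin (m + 1) → ℕ))
    (fun w _ => (⟨w (Fin.last m), fun i => w i.castSucc⟩ : Σ _ : ℕ, Fin m → ℕ))
    ?_ ?_ ?_ ?_ ?_).symm
  · rintro ⟨b, w⟩ h
    simp only [mem_sigma, mem_filter, mem_range, wordsOfContent, Fintype.mem_piFinset] at h ⊢
    refine ⟨fun i => ?_, ?_⟩
    · refine Fin.lastCases ?_ (fun i => ?_) i
      · simpa using h.1.1
      · simpa using h.2.1 i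
    · rw [map_univ_snoc, h.2.2, Multiset.cons_erase h.1.2]
  · intro w h
    simp only [mem_sigma, mem_filter, mem_range, wordsOfContent, Fintype.mem_piFinset] at h ⊢
    have h2 := h.2
    rw [← Fin.snoc_init_self w, map_univ_snoc] at h2
    refine ⟨⟨h.1 _, ?_⟩, fun i => h.1 _, ?_⟩
    · rw [← h2]; exact Multiset.mem_cons_self _ _
    · rw [← h2, Multiset.erase_cons_head]; rfl
  · rintro ⟨b, w⟩ _
    simp
  · intro w _
    exact Fin.snoc_init_self w
  · intros; rfl

/-- The number of multisets of content `M`, drawn from the first `P` elements of the periodic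
extension of the alphabet `0, …, q - 1`. -/
def contentCount (q : ℕ) (κ : ℕ → ℕ) (K : Finset ℕ) (M : Multiset ℕ) (P : ℕ) : ℚ :=
  ∏ k ∈ K, (Nat.multichoose (Nat.count (fun p => κ (p % q) = k) P) (M.count k) : ℚ)

theorem contentCount_zero (q : ℕ) (κ : ℕ → ℕ) {K : Finset ℕ} {M : Multiset ℕ} {k : ℕ}
    (hk : k ∈ K) (hM : k ∈ M) : contentCount q κ K M 0 = 0 := by
  refine Finset.prod_eq_zero hk ?_
  obtain ⟨c, hc⟩ := Nat.exists_eq_succ_of_ne_zero (Multiset.count_pos.2 hM).ne'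
  simp [hc]

/-- The new multisets are those using position `P`; deleting one copy of it leaves any multiset of
the smaller content. Only one class changes, so this is Pascal's rule for `Nat.multichoose`. -/
theorem contentCount_succ_sub (q : ℕ) (κ : ℕ → ℕ) {K : Finset ℕ} (M : Multiset ℕ) (P : ℕ)
    (hK : κ (P % q) ∈ K) :
    contentCount q κ K M (P + 1) - contentCount q κ K M P =
      if κ (P % q) ∈ M then contentCount q κ K (M.erase (κ (P % q))) (P + 1) else 0 := by
  set k := κ (P % q) with hk
  have hoff : ∀ j ∈ K.erase k, Nat.count (fun p => κ (p % q) = j) (P + 1) =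
      Nat.count (fun p => κ (p % q) = j) P := fun j hj => by
    rw [Nat.count_succ, if_neg (by rw [← hk]; exact (ne_of_mem_erase hj).symm), add_zero]
  have hon : Nat.count (fun p => κ (p % q) = k) (P + 1) =
      Nat.count (fun p => κ (p % q) = k) P + 1 := by
    rw [Nat.count_succ, if_pos hk.symm]
  simp only [contentCount]
  rw [← Finset.mul_prod_erase K _ hK, ← Finset.mul_prod_erase K _ hK,
    ← Finset.mul_prod_erase K _ hK, hon]
  have h1 : ∏ j ∈ K.erase k, (Nat.multichoose (Nat.count (fun p => κ (p % q) = j) (P + 1))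
      (M.count j) : ℚ) = ∏ j ∈ K.erase k,
        (Nat.multichoose (Nat.count (fun p => κ (p % q) = j) P) (M.count j) : ℚ) :=
    Finset.prod_congr rfl fun j hj => by rw [hoff j hj]
  have h2 : ∏ j ∈ K.erase k, (Nat.multichoose (Nat.count (fun p => κ (p % q) = j) (P + 1))
      ((M.erase k).count j) : ℚ) = ∏ j ∈ K.erase k,
        (Nat.multichoose (Nat.count (fun p => κ (p % q) = j) P) (M.count j) : ℚ) :=
    Finset.prod_congr rfl fun j hj => by
      rw [hoff j hj, Multiset.count_erase_of_ne (ne_of_mem_erase hj)]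
  rw [h1, h2, ← sub_mul]
  split_ifs with hM
  · obtain ⟨c, hc⟩ := Nat.exists_eq_succ_of_ne_zero (Multiset.count_pos.2 hM).ne'
    rw [Multiset.count_erase_self, hc, Nat.succ_sub_one, Nat.succ_eq_add_one,
      Nat.multichoose_succ_succ]
    push_cast
    ring
  · rw [Multiset.count_eq_zero_of_notMem hM]
    simp

/-- The generating function of words of given content by descents. -/
theorem sum_wordsOfContent (q : ℕ) (κ : ℕ → ℕ) (K : Finset ℕ) (hκ : ∀ j < q, κ j ∈ K) (m : ℕ)
    (M : Multiset ℕ) (hM : M.card = m) (hMK : ∀ k ∈ M, k ∈ K) (r : ℕ) (hr : r ≤ q) :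
    ∑ w ∈ wordsOfContent q κ m M, (X : PowerSeries ℚ) ^ desBounded r w =
      (1 - X) ^ (m + 1) * PowerSeries.mk fun t => contentCount q κ K M (t * q + r) := by
  induction m generalizing M r with
  | zero =>
    obtain rfl := Multiset.card_eq_zero.1 hM
    have hw : wordsOfContent q κ 0 0 = {Fin.elim0} := by
      ext w
      obtain rfl := Subsingleton.elim w Fin.elim0
      exact iff_of_true 
        (mem_filter.2 ⟨Fintype.mem_piFinset.2 fun i => i.elim0, rfl⟩) (mem_singleton_self _)
    rw [hw, Finset.sum_singleton]
    simp only [desBounded, contentCount, Multiset.count_zero, Nat.multichoose_zero_right]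
    ext t
    rcases t with _ | t <;> simp [sub_mul, coeff_succ_X_mul, coeff_one]
  | succ m ih =>
    obtain ⟨k, hk⟩ := Multiset.card_pos_iff_exists_mem.1 (by omega : 0 < M.card)
    -- The last letter `b` is matched with the increments at positions congruent to `b` modulo `q`.
    rw [sum_wordsOfContent_succ, pow_succ _ (m + 1), mul_assoc,
      ← sum_level_series (contentCount q κ K M) (contentCount_zero q κ (hMK k hk) hk) hr,
      Finset.mul_sum]
    refine Finset.sum_congr rfl fun b hb => ?_
    have hb := mem_range.1 hb
    have hmod : ∀ v, (v * q + b) % q = b := fun v => by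
      rw [Nat.mul_add_mod_self_right, Nat.mod_eq_of_lt hb]
    have hd : ∀ v, contentCount q κ K M (v * q + b + 1) - contentCount q κ K M (v * q + b) =
        if κ b ∈ M then contentCount q κ K (M.erase (κ b)) (v * q + b + 1) else 0 := fun v => by
      rw [contentCount_succ_sub _ _ _ _ (by rw [hmod]; exact hκ b hb), hmod]
    simp only [hd]
    by_cases hbM : κ b ∈ M
    · simp only [if_pos hbM, desBounded_snoc, pow_add _ _ (if r ≤ b then 1 else 0)]
      rw [← Finset.sum_mul, ih (M.erase (κ b)) (by rw [Multiset.card_erase_of_mem hbM, hM]; rfl)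
        (fun k hk => hMK k (Multiset.mem_of_mem_erase hk)) (b + 1) hb]
      simp only [add_assoc]
      ring
    · simp only [if_neg hbM]
      rw [show (PowerSeries.mk fun _ : ℕ => (0 : ℚ)) = 0 from rfl]
      simp

/-- The `j`-th smallest letter in `{-n, …, n - 1} \ {0}`. -/
def letter (n j : ℕ) : ℤ := if j < n then (j : ℤ) - n else j - n + 1

theorem count_letter_mul_add (n q k t r : ℕ) :
    Nat.count (fun p => (letter n (p % q)).natAbs = k) (t * q + r) =
      t * Nat.count (fun p => (letter n (p % q)).natAbs = k) q +
        Nat.count (fun p => (letter n (p % q)).natAbs = k) r := by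
  induction t with
  | zero => simp
  | succ t ih =>
    rw [show (t + 1) * q + r = q + (t * q + r) by ring, Nat.count_add]
    simp only [Nat.add_mod_left]
    rw [ih]
    ring

/-- The letter `-k` sits at position `n - k` and `k` at `n + k - 1`; for `k = n` the latter lies
outside the alphabet. -/
theorem count_letter (n k P : ℕ) (hP : P ≤ 2 * n - 1) :
    Nat.count (fun p => (letter n (p % (2 * n - 1))).natAbs = k) P =
      (if 1 ≤ k ∧ k ≤ n ∧ n < P + k then 1 else 0) +
        if 1 ≤ k ∧ n + k ≤ P then 1 else 0 := by
  induction P with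
  | zero =>
    rw [Nat.count_zero, if_neg (by omega), if_neg (by omega)]
  | succ P ih =>
    rw [Nat.count_succ, ih (by omega), Nat.mod_eq_of_lt (by omega)]
    unfold letter
    split_ifs <;> omega

end SignedInv

/-! ### Specialisation to the base multiset and to `V`. -/

namespace SignedInv

open PowerSeries Finset

theorem count_baseMultiset_self (i : ℕ) : (baseMultiset (i + 1)).count (i + 1) = 1 := by
  simp [baseMultiset]

theorem count_baseMultiset_of_mem {i k : ℕ} (hk : k ∈ Icc 1 i) :
    (baseMultiset (i + 1)).count k = 2 := by
  have h1 : Multiset.count k (Icc 1 i).val = 1 :=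
    Multiset.count_eq_one_of_mem (Icc 1 i).nodup hk
  have h2 : k ≠ i + 1 := by have := mem_Icc.1 hk; omega
  simp [baseMultiset, h1, h2]

theorem mem_baseMultiset {i k : ℕ} (hk : k ∈ baseMultiset (i + 1)) : k ∈ Icc 1 (i + 1) := by
  simp only [baseMultiset, Nat.add_sub_cancel, Multiset.mem_add, Multiset.mem_singleton] at hk
  rcases hk with hk | rfl
  · have := Multiset.mem_of_mem_nsmul hk
    simp only [Finset.mem_val, mem_Icc] at this ⊢
    omega
  · simp

theorem card_baseMultiset (i : ℕ) : (baseMultiset (i + 1)).card = 2 * i + 1 := by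
  simp [baseMultiset]

theorem natAbs_letter_mem {i j : ℕ} (hj : j < 2 * i + 1) :
    (letter (i + 1) j).natAbs ∈ Icc 1 (i + 1) := by
  rw [mem_Icc]; unfold letter; split_ifs <;> omega

/-- Each `k ≤ i` has `2t + 1` available positions and is chosen twice, giving `(2t+2).choose 2`; the
class `i + 1` has `t + 1` and is chosen once. -/
theorem contentCount_baseMultiset (i t : ℕ) :
    contentCount (2 * i + 1) (fun j => (letter (i + 1) j).natAbs) (Icc 1 (i + 1))
        (baseMultiset (i + 1)) (t * (2 * i + 1) + (i + 1)) =
      ((t : ℚ) + 1) ^ (i + 1) * (2 * t + 1) ^ i := by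
  have hq : ∀ k P, P ≤ 2 * i + 1 →
      Nat.count (fun p => (letter (i + 1) (p % (2 * i + 1))).natAbs = k) P =
        (if 1 ≤ k ∧ k ≤ i + 1 ∧ i + 1 < P + k then 1 else 0) +
          if 1 ≤ k ∧ i + 1 + k ≤ P then 1 else 0 := fun k P hP => count_letter (i + 1) k P hP
  rw [contentCount, Finset.prod_Icc_succ_top (by omega)]
  have h1 : ∀ k ∈ Icc 1 i, (Nat.multichoose (Nat.count
      (fun p => (letter (i + 1) (p % (2 * i + 1))).natAbs = k) (t * (2 * i + 1) + (i + 1)))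
        ((baseMultiset (i + 1)).count k) : ℚ) = (t + 1) * (2 * t + 1) := by
    intro k hk
    rw [count_baseMultiset_of_mem hk, count_letter_mul_add, hq _ _ le_rfl, hq _ _ (by omega)]
    have hk := mem_Icc.1 hk
    rw [if_pos (by omega), if_pos (by omega), if_pos (by omega), if_neg (by omega),
      Nat.multichoose_eq, show t * (1 + 1) + (1 + 0) + 2 - 1 = 2 * t + 2 by omega,
      Nat.cast_choose_two]
    push_cast
    ring
  rw [Finset.prod_congr rfl h1, count_baseMultiset_self, count_letter_mul_add, hq _ _ le_rfl,
    hq _ _ (by omega), if_pos (by omega), if_neg (by omega), if_pos (by omega),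
    if_neg (by omega), Nat.multichoose_one_right]
  simp only [prod_const, Nat.card_Icc, Nat.add_sub_cancel]
  push_cast
  rw [mul_pow]
  ring

/-- `letter n` is increasing and positive exactly from index `n` on, so the final type B descent is
the bound `n`. -/
theorem desB_letter {n m : ℕ} (w : Fin m → ℕ) :
    desB (fun i => letter n (w i)) = desBounded n w := by
  rw [desB, DesB, Finset.card_filter, desBounded]
  refine Finset.sum_congr rfl fun i _ => ?_
  congr 1
  rw [eq_iff_iff]
  by_cases h : i.val + 1 < m
  · rw [dif_pos h]
    simp only [Fin.snoc, Fin.val_succ, h, dif_pos, cast_eq]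
    change letter n (w ⟨i + 1, h⟩) < letter n (w i) ↔ w ⟨i + 1, h⟩ + 1 ≤ w i
    unfold letter
    split_ifs <;> omega
  · rw [dif_neg h]
    simp only [Fin.snoc, Fin.val_succ, h, dif_neg, not_false_eq_true, cast_eq]
    unfold letter
    split_ifs <;> omega

theorem sum_V_eq_sum_words {β : Type*} [AddCommMonoid β] (n : ℕ) (hn : 1 ≤ n) (f : ℕ → β) :
    ∑ σ ∈ V n, f (desB σ) =
      ∑ w ∈ wordsOfContent (2 * n - 1) (fun j => (letter n j).natAbs) (2 * n - 1)
        (baseMultiset n), f (desBounded n w) := by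
  obtain ⟨i, rfl⟩ : ∃ i, n = i + 1 := ⟨n - 1, by omega⟩
  symm
  refine Finset.sum_bij (fun w _ => fun j => letter (i + 1) (w j)) ?_ ?_ ?_ ?_
  · intro w hw
    simp only [wordsOfContent, mem_filter, Fintype.mem_piFinset, mem_range] at hw
    refine mem_filter.2 ⟨mem_signedPerms.2 hw.2, ?_⟩
    have h : i + 1 ∈ baseMultiset (i + 1) :=
      Multiset.count_pos.1 (by rw [count_baseMultiset_self]; exact one_pos)
    rw [← hw.2, Multiset.mem_map] at h
    obtain ⟨j, -, hj⟩ := h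
    refine ⟨j, ?_⟩
    have := hw.1 j
    revert hj
    unfold letter
    push_cast
    split_ifs <;> omega
  · intro w _ w' _ h
    funext j
    have := congrFun h j
    simp only [letter] at this
    split_ifs at this <;> omega
  · intro σ hσ
    obtain ⟨hU, j₀, hj₀⟩ := mem_filter.1 hσ
    have hc := mem_signedPerms.1 hU
    -- The absolute value `i + 1` occurs once and is already taken with a minus sign.
    have hne : ∀ j, σ j ≠ (i + 1 : ℕ) := by
      intro j hj
      have hjj : j ≠ j₀ := by
        rintro rfl
        omega
      have h1 := count_baseMultiset_self i
      rw [← hc, Multiset.count_map, ← Finset.filter_val, Finset.card_val,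
        Finset.card_eq_one] at h1
      obtain ⟨a, ha⟩ := h1
      have h2 : j ∈ ({a} : Finset _) := by rw [← ha, mem_filter]; exact ⟨mem_univ _, by omega⟩
      have h3 : j₀ ∈ ({a} : Finset _) := by rw [← ha, mem_filter]; exact ⟨mem_univ _, by omega⟩
      exact hjj ((mem_singleton.1 h2).trans (mem_singleton.1 h3).symm)
    have hr : ∀ j, 1 ≤ (σ j).natAbs ∧ (σ j).natAbs ≤ i + 1 := by
      intro j
      rw [← mem_Icc]
      refine mem_baseMultiset ?_
      rw [← hc]
      exact Multiset.mem_map.2 ⟨j, mem_univ j, rfl⟩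
    have hl : ∀ j, letter (i + 1)
        (if σ j < 0 then σ j + (i + 1) else σ j + i).toNat = σ j := by
      intro j
      have h1 := hr j
      have h2 := hne j
      unfold letter
      split_ifs <;> omega
    refine ⟨fun j => (if σ j < 0 then σ j + (i + 1) else σ j + i).toNat, ?_, funext hl⟩
    simp only [wordsOfContent, mem_filter, Fintype.mem_piFinset, mem_range, hl]
    refine ⟨fun j => ?_, hc⟩
    have h1 := hr j
    have h2 := hne j
    split_ifs <;> omega
  · intro w _
    rw [desB_letter]

theorem sum_desB_V (i : ℕ) :
    ∑ σ ∈ V (i + 1), (X : PowerSeries ℚ) ^ desB σ = (1 - X) ^ (2 * i + 2) *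
      PowerSeries.mk fun t : ℕ => ((t : ℚ) + 1) ^ (i + 1) * (2 * t + 1) ^ i := by
  rw [sum_V_eq_sum_words (i + 1) (by omega) (fun d => (X : PowerSeries ℚ) ^ d)]
  change ∑ w ∈ wordsOfContent (2 * i + 1) _ (2 * i + 1) _, _ = _
  rw [sum_wordsOfContent (2 * i + 1) _ (Icc 1 (i + 1)) (fun j hj => natAbs_letter_mem hj)
    (2 * i + 1) _ (card_baseMultiset i) (fun k hk => mem_baseMultiset hk) (i + 1) (by omega)]
  simp only [contentCount_baseMultiset]

end SignedInv

theorem theorem3p1 (n : ℕ) (hn : 1 ≤ n) :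
    (∑ σ ∈ SignedInv.V n, (Polynomial.X : Polynomial ℤ) ^ SignedInv.desB σ
      = ∑ e ∈ SignedInv.I (2 * n - 1),
          (Polynomial.X : Polynomial ℤ) ^ SignedInv.asc SignedInv.sSeq e) ∧
    (∑ σ ∈ SignedInv.V n, (PowerSeries.X : PowerSeries ℚ) ^ SignedInv.desB σ)
        * ((1 - PowerSeries.X : PowerSeries ℚ) ^ (2 * n))⁻¹
      = PowerSeries.mk (fun t : ℕ => ((t : ℚ) + 1) ^ n * (2 * (t : ℚ) + 1) ^ (n - 1)) := by
  obtain ⟨i, rfl⟩ : ∃ i, n = i + 1 := ⟨n - 1, by omega⟩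
  constructor
  -- The identity of rational power series descends to integer polynomials along an injective map.
  · have h := (SignedInv.sum_desB_V i).trans (SignedInv.sum_asc_I i).symm
    have hinj : Function.Injective (fun p : Polynomial ℤ =>
        ((p.map (Int.castRingHom ℚ) : Polynomial ℚ) : PowerSeries ℚ)) :=
      Polynomial.coe_injective ℚ |>.comp
        (Polynomial.map_injective _ (RingHom.injective_int _))
    change _ = ∑ e ∈ SignedInv.I (2 * i + 1), _
    apply hinj
    simp only [Polynomial.map_sum, Polynomial.map_pow, Polynomial.map_X,
      ← Polynomial.coeToPowerSeries.ringHom_apply, map_sum, map_pow]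
    simpa only [Polynomial.coeToPowerSeries.ringHom_apply, Polynomial.coe_X] using h
  · rw [SignedInv.sum_desB_V, mul_right_comm, mul_add_one, PowerSeries.mul_inv_cancel, one_mul]
    · rfl
    · simp
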